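/- A \emph{mixed graph} $G$ is a finite simple graph on a vertex set $V$, some of whose edges are oriented. We write $\overrightarrow{uv}\in E$ for an edge oriented from $u$ to $v$ and $\overline{uv}\in E$ for an unoriented edge. Its Hermitian adjacency matrix $H=(h_{uv})\in\mathbb{C}^{V\times V}$ is given by $h_{uv}=i$ if $\overrightarrow{uv}\in E$, $h_{uv}=-i$ if $\overrightarrow{vu}\in E$, $h_{uv}=1$ if $\overline{uv}\in E$, and $h_{uv}=0$ otherwise. Its Hermitian quasi-Laplacian matrix is $Q_H=D+H$, where $D$ is the diagonal matrix of the vertex degrees in the underlying graph. For $W\subseteq V$, $Q_H[W]$ is the principal submatrix of $Q_H$ with rows and columns indexed by $W$ (the determinant of the empty matrix is $1$). A \emph{substructure} $R=(X,Y)$ of $G$ consists of sets $X=V(R)\subseteq V$ and $Y\subseteq E$; end points of edges in $Y$ need not lie in $X$. It is \emph{square} if $|X|=|Y|$. Its components are those of the bipartite incidence graph on $X\sqcup Y$ in which a vertex $v \in X$ is joined to an edge $e \in Y$ if $v$ is an end point of $e$. A \emph{rootless tree} is a substructure obtained from a tree in $G$ by deleting one vertex while keeping all edges. A \emph{unicyclic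 graph} is a substructure that contains all end points of its edges and is a connected graph with exactly one cycle. For a cycle traversed in a fixed direction, let $a$ and $b$ be the numbers of edges oriented along and against that direction, and $c$ the number of unoriented edges. The cycle is of \emph{type I} if $a+b$ is odd, of \emph{type II} if $\frac{|a-b|}{2}+c$ is an odd integer, and of \emph{type III} if $\frac{|a-b|}{2}+c$ is an even integer. A unicyclic graph has the type of its cycle. A \emph{special square substructure} is a square substructure each of whose components is a rootless tree or a unicyclic graph not of type III. \textbf{Theorem.} Let $G$ be a mixed graph with vertex set $V$ and let $W\subseteq V$. Then $$\det(Q_H[W])=\sum_{R}2^{x+2y},$$ where the sum runs over all special square substructures $R$ of $G$ with $V(R)=W$, and $x$ and $y$ denote the numbers of components of $R$ that are unicyclic graphs of type I and of type II, respectively. -/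

import Mathlib

/-- A mixed graph on `V`: a simple graph, some of whose edges carry an orientation.
`arc u v` says that the edge `uv` is oriented from `u` to `v`. -/
structure MixedGraph (V : Type*) where
  /-- the underlying unoriented simple graph -/
  graph : SimpleGraph V
  /-- the oriented edges -/
  arc : V → V → Prop
  adj_of_arc : ∀ u v, arc u v → graph.Adj u v
  arc_asymm : ∀ u v, arc u v → ¬ arc v u

namespace MixedGraph

variable {V : Type*}

open Classical in
/-- The Hermitian adjacency matrix `H(G)`. -/
noncomputable def hermitianAdjacency (G : MixedGraph V) : Matrix V V ℂ :=
  Matrix.of fun u v =>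
    if G.arc u v then Complex.I
    else if G.arc v u then -Complex.I
    else if G.graph.Adj u v then 1
    else 0

open Classical in
/-- The diagonal matrix `D(G)` of the vertex degrees of the underlying graph. -/
noncomputable def degreeMatrix [Fintype V] (G : MixedGraph V) : Matrix V V ℂ :=
  Matrix.diagonal fun u => (G.graph.degree u : ℂ)

/-- The Hermitian quasi-Laplacian matrix `Q_H(G) = D(G) + H(G)`. -/
noncomputable def quasiLaplacian [Fintype V] (G : MixedGraph V) : Matrix V V ℂ :=
  G.degreeMatrix + G.hermitianAdjacency

/-- A substructure of `G`: a set of vertices together with a set of edges of `G`. The end points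
of its edges need not be among its vertices. -/
@[ext]
structure Substructure (G : MixedGraph V) where
  verts : Finset V
  edges : Finset (Sym2 V)
  edges_subset : ∀ e ∈ edges, e ∈ G.graph.edgeSet

namespace Substructure

variable {G : MixedGraph V}

noncomputable instance [Fintype V] [DecidableEq V] : Fintype G.Substructure :=
  Fintype.ofInjective (fun R : G.Substructure => (R.verts, R.edges)) (by
    intro R R' h
    simp only [Prod.mk.injEq] at h
    exact Substructure.ext h.1 h.2)

/-- A square substructure has as many vertices as edges. -/
def IsSquare (R : G.Substructure) : Prop :=
  R.verts.card = R.edges.card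

/-- All end points of edges of `R` are vertices of `R`, so that `R` is a (mixed) graph. -/
def IsGraph (R : G.Substructure) : Prop :=
  ∀ e ∈ R.edges, ∀ v ∈ e, v ∈ R.verts

/-- The simple graph on the vertices of `R` formed by the edges of `R` that have both end points
in `R`. When `R` is a graph, it is the underlying graph of `R`. -/
def underlying (R : G.Substructure) : SimpleGraph R.verts where
  Adj u v := s((u : V), (v : V)) ∈ R.edges
  symm := ⟨fun u v h => by rwa [Sym2.eq_swap]⟩
  loopless := ⟨fun u h => G.graph.irrefl ((SimpleGraph.mem_edgeSet _).1 (R.edges_subset _ h))⟩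

/-- `R` is a mixed tree. -/
def IsTree (R : G.Substructure) : Prop :=
  R.IsGraph ∧ R.underlying.IsTree

/-- Delete the vertex `r`, keeping all edges. -/
def deleteVertex [DecidableEq V] (R : G.Substructure) (r : V) : G.Substructure where
  verts := R.verts.erase r
  edges := R.edges
  edges_subset := R.edges_subset

open Classical in
/-- `R` is a rootless tree: a mixed tree from which one vertex, the root, has been deleted, while
the edges at the root are kept. -/
def IsRootlessTree (R : G.Substructure) : Prop :=
  ∃ T : G.Substructure, T.IsTree ∧ ∃ r ∈ T.verts, R = T.deleteVertex r

/-- `R` is a unicyclic graph: a connected graph with exactly one cycle. Cycles are represented by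
closed walks, and two of them are the same cycle if they have the same edges. -/
def IsUnicyclic (R : G.Substructure) : Prop :=
  R.IsGraph ∧ R.underlying.Connected ∧
    ∃ (u : R.verts) (p : R.underlying.Walk u u), p.IsCycle ∧
      ∀ (w : R.verts) (q : R.underlying.Walk w w), q.IsCycle → ∀ e, e ∈ q.edges ↔ e ∈ p.edges

section Walks

variable {R : G.Substructure} {u v : R.verts}

open Classical in
/-- The number `a` of edges directed along the direction of traversal. -/
noncomputable def numForward (p : R.underlying.Walk u v) : ℕ :=
  p.darts.countP fun d => G.arc (d.fst : V) (d.snd : V)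

open Classical in
/-- The number `b` of edges directed against the direction of traversal. -/
noncomputable def numBackward (p : R.underlying.Walk u v) : ℕ :=
  p.darts.countP fun d => G.arc (d.snd : V) (d.fst : V)

open Classical in
/-- The number `c` of unoriented edges. -/
noncomputable def numUnoriented (p : R.underlying.Walk u v) : ℕ :=
  p.darts.countP fun d => ¬ G.arc (d.fst : V) (d.snd : V) ∧ ¬ G.arc (d.snd : V) (d.fst : V)

/-- Type I: the number of directed edges is odd. -/
def IsTypeI (p : R.underlying.Walk u u) : Prop :=
  Odd (numForward p + numBackward p)

/-- Type II: `|a - b| / 2 + c` is an odd integer. -/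
def IsTypeII (p : R.underlying.Walk u u) : Prop :=
  ∃ k : ℤ, Odd k ∧
    |(numForward p : ℚ) - (numBackward p : ℚ)| / 2 + (numUnoriented p : ℚ) = (k : ℚ)

/-- Type III: `|a - b| / 2 + c` is an even integer. -/
def IsTypeIII (p : R.underlying.Walk u u) : Prop :=
  ∃ k : ℤ, Even k ∧
    |(numForward p : ℚ) - (numBackward p : ℚ)| / 2 + (numUnoriented p : ℚ) = (k : ℚ)

end Walks

/-- `R` is a unicyclic graph whose cycle is of type I. -/
def IsUnicyclicI (R : G.Substructure) : Prop :=
  R.IsUnicyclic ∧ ∃ (u : R.verts) (p : R.underlying.Walk u u), p.IsCycle ∧ IsTypeI p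

/-- `R` is a unicyclic graph whose cycle is of type II. -/
def IsUnicyclicII (R : G.Substructure) : Prop :=
  R.IsUnicyclic ∧ ∃ (u : R.verts) (p : R.underlying.Walk u u), p.IsCycle ∧ IsTypeII p

/-- `R` is a unicyclic graph whose cycle is of type III. -/
def IsUnicyclicIII (R : G.Substructure) : Prop :=
  R.IsUnicyclic ∧ ∃ (u : R.verts) (p : R.underlying.Walk u u), p.IsCycle ∧ IsTypeIII p

/-- The incidence graph of `R`: its nodes are the vertices and the edges of `R`, and a vertex is
joined to the edges of which it is an end point. Its connected components are the components
of `R`. -/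
def incidence (R : G.Substructure) : SimpleGraph (R.verts ⊕ R.edges) where
  Adj
    | Sum.inl v, Sum.inr e => (v : V) ∈ (e : Sym2 V)
    | Sum.inr e, Sum.inl v => (v : V) ∈ (e : Sym2 V)
    | _, _ => False
  symm := ⟨by rintro (v | e) (w | f) h <;> exact h⟩
  loopless := ⟨by rintro (v | e) h <;> exact h⟩

open Classical in
/-- The component of `R` given by a connected component of its incidence graph, as a
substructure. -/
noncomputable def component (R : G.Substructure) (c : R.incidence.ConnectedComponent) :
    G.Substructure where
  verts := R.verts.filter fun v =>
    ∃ h : v ∈ R.verts, R.incidence.connectedComponentMk (Sum.inl ⟨v, h⟩) = c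
  edges := R.edges.filter fun e =>
    ∃ h : e ∈ R.edges, R.incidence.connectedComponentMk (Sum.inr ⟨e, h⟩) = c
  edges_subset e he := R.edges_subset e (Finset.mem_filter.1 he).1

/-- A special square substructure: a square substructure each of whose components is a rootless
tree or a unicyclic graph not of type III. -/
def IsSpecialSquare (R : G.Substructure) : Prop :=
  R.IsSquare ∧ ∀ c : R.incidence.ConnectedComponent,
    (R.component c).IsRootlessTree ∨
      ((R.component c).IsUnicyclic ∧ ¬ (R.component c).IsUnicyclicIII)

noncomputable instance : DecidablePred (IsSpecialSquare (G := G)) := Classical.decPred _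

/-- The number `x` of components that are unicyclic graphs of type I. -/
noncomputable def numTypeI (R : G.Substructure) : ℕ :=
  {c : R.incidence.ConnectedComponent | (R.component c).IsUnicyclicI}.ncard

/-- The number `y` of components that are unicyclic graphs of type II. -/
noncomputable def numTypeII (R : G.Substructure) : ℕ :=
  {c : R.incidence.ConnectedComponent | (R.component c).IsUnicyclicII}.ncard

end Substructure

end MixedGraph

/-! ### Determinants of products, of triangular matrices and of block matrices. -/

namespace Matrix

open Finset

/-! Let N be the vertex-edge incidence matrix with entry -i at the head of an oriented edge and 1 at
every other end point. Then `Q_H = N Nᴴ`, and Cauchy–Binet writes `det Q_H[W]` as the sum, over edge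
sets Y with |Y| = |W|, of the Gram determinant of the block of N with rows W and columns Y. It
remains to evaluate this `gramDet` for one square substructure (`gramDet_of_isSquare`).

An entry of N is nonzero only within a component, so the Gram determinant factors over components. A
component with fewer edges than vertices contributes 0; if none is deficient, squareness of the
whole makes every component square. Adding the missing end points to a square component gives a
connected graph with at most one new vertex. With one new vertex, the component is a rootless tree;
with none, it is unicyclic.

For a rootless tree, pairing each vertex with the edge towards the root makes the block triangular
with diagonal entries of modulus 1, so the factor is 1. For a unicyclic graph the factor is |1 -
w|², where w is the product of the numbers -h along the cycle (`gramDet_of_isCycle`). Types I, II,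
III give w = ±i, -1, 1, hence factors 2, 4, 0. -/

theorem det_submatrix_eq_zero_of_not_injective {m n K : Type*} [Fintype m] [DecidableEq m] [CommRing K]
    (B : Matrix n m K) {f : m → n}
    (hf : ¬ Function.Injective f) : (B.submatrix f id).det = 0 := by
  simp only [Function.Injective, not_forall] at hf
  obtain ⟨i, j, hij, hne⟩ := hf
  exact det_zero_of_row_eq hne (by ext k; simp [hij])

section Determinants

variable {m n K : Type*} [Fintype m] [DecidableEq m] [Fintype n] [CommRing K]

/-- Expansion of the determinant of a product of rectangular matrices over all functions. -/
theorem det_mul_eq_sum_pi (A : Matrix m n K) (B : Matrix n m K) :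
    (A * B).det = ∑ f : m → n, (∏ i, A i (f i)) * (B.submatrix f id).det := by
  classical
  have h : A * B = fun i => ∑ j, A i j • B j := by
    ext i k
    simp [Matrix.mul_apply, Finset.sum_apply]
  have h2 : (A * B).det = detRowAlternating (fun i => ∑ j, A i j • B j) := by
    rw [← h]; rfl
  rw [h2]
  have := (detRowAlternating (R := K) (n := m)).toMultilinearMap.map_sum
    (fun i j => A i j • B j)
  refine this.trans (Finset.sum_congr rfl fun f _ => ?_)
  exact (detRowAlternating (R := K) (n := m)).toMultilinearMap.map_smul_univ
    (fun i => A i (f i)) (fun i => B (f i))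

/-- The Cauchy–Binet formula. -/
theorem det_mul_eq_sum_powersetCard (A : Matrix m n K) (B : Matrix n m K) :
    (A * B).det = ∑ s ∈ powersetCard (Fintype.card m) (univ : Finset n),
      (A.submatrix id (Subtype.val : s → n) * B.submatrix (Subtype.val : s → n) id).det := by
  classical
  set F : (m → n) → K := fun f => (∏ i, A i (f i)) * (B.submatrix f id).det with hF
  have h1 : ∀ s : Finset n,
      (A.submatrix id (Subtype.val : s → n) * B.submatrix (Subtype.val : s → n) id).det
        = ∑ f : m → n with ∀ i, f i ∈ s, F f := by
    intro s
    rw [det_mul_eq_sum_pi]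
    refine Finset.sum_bij' (fun f _ => fun i => (f i : n))
      (fun f hf => fun i => ⟨f i, (Finset.mem_filter.1 hf).2 i⟩) ?_ ?_ ?_ ?_ ?_
    · intro f _; simp
    · intro f _; simp
    · intro f _; rfl
    · intro f _; rfl
    · intro f _; rfl
  simp_rw [h1]
  rw [det_mul_eq_sum_pi]
  simp_rw [Finset.sum_filter]
  -- An injective `f` takes values in exactly one set of size `card m`, its image; the other
  -- functions contribute 0.
  rw [Finset.sum_comm]
  refine Finset.sum_congr rfl fun f _ => ?_
  change F f = _
  by_cases hf : Function.Injective f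
  · rw [Finset.sum_eq_single (univ.image f)]
    · simp
    · intro s hs hne
      rw [if_neg]
      intro h
      apply hne
      symm
      apply Finset.eq_of_subset_of_card_le
      · intro x hx
        obtain ⟨i, -, rfl⟩ := Finset.mem_image.1 hx
        exact h i
      · rw [Finset.card_image_of_injective _ hf, (mem_powersetCard.1 hs).2, Finset.card_univ]
    · intro h
      exact absurd (mem_powersetCard.2 ⟨subset_univ _, by
        rw [Finset.card_image_of_injective _ hf, Finset.card_univ]⟩) h
  · have : F f = 0 := by simp [hF, det_submatrix_eq_zero_of_not_injective B hf]
    simp [this]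

theorem det_mul_eq_zero_of_card_lt (A : Matrix m n K) (B : Matrix n m K)
    (h : Fintype.card n < Fintype.card m) : (A * B).det = 0 := by
  rw [det_mul_eq_sum_powersetCard, powersetCard_eq_empty.2 (by simpa using h), sum_empty]

/-- A matrix whose off-diagonal nonzero entries strictly increase a rank function has the product
of its diagonal entries as determinant. -/
theorem det_eq_prod_diag_of_rank {α : Type*} [LinearOrder α] (M : Matrix m m K) (d : m → α)
    (h : ∀ u v, u ≠ v → M u v ≠ 0 → d u < d v) : M.det = ∏ v, M v v := by
  rw [det_apply]
  rw [Finset.sum_eq_single 1]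
  · simp
  · intro σ _ hσ
    have hne : (univ.filter fun v => σ v ≠ v).Nonempty := by
      by_contra hcon
      rw [Finset.not_nonempty_iff_eq_empty, Finset.filter_eq_empty_iff] at hcon
      exact hσ (Equiv.ext fun v => by simpa using hcon (mem_univ v))
    -- A moved index of least rank: its image under `σ` is moved as well, so it cannot have smaller
    -- rank and the entry must vanish.
    obtain ⟨v, hv, hmin⟩ := Finset.exists_min_image _ d hne
    have hv' : σ v ≠ v := (mem_filter.1 hv).2
    have hz : M (σ v) v = 0 := by
      by_contra hM
      have hlt := h _ _ hv' hM
      exact absurd (hmin (σ v) (by simpa using hv')) (not_le.2 hlt)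
    have hp : ∏ i, M (σ i) i = 0 := Finset.prod_eq_zero (mem_univ v) hz
    rw [hp, smul_zero]
  · simp

/-- The determinant of a block diagonal matrix, the blocks being the fibres of a map. -/
theorem det_eq_prod_det_toSquareBlock {α : Type*} [Fintype α] [DecidableEq α] (M : Matrix m m K)
    (b : m → α) (h : ∀ u v, b u ≠ b v → M u v = 0) :
    M.det = ∏ a, (M.toSquareBlock b a).det := by
  -- Entries vanish on both sides of the blocks, so any ordering of the labels makes `M` block
  -- triangular.
  let e := Fintype.equivFin α
  have hM : M.BlockTriangular (e ∘ b) := by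
    intro u v huv
    refine h u v fun hb => ?_
    simp [hb] at huv
  rw [hM.det_fintype, ← e.prod_comp]
  refine Finset.prod_congr rfl fun a _ => ?_
  let f : {v // b v = a} ≃ {v // (e ∘ b) v = e a} := Equiv.subtypeEquivRight fun v => by simp
  rw [← det_submatrix_equiv_self f]
  rfl

end Determinants

/-- Different identifications of rows with columns change the determinant only by a sign, which
`normSq` ignores. -/
theorem det_mul_conjTranspose_eq_normSq {m n : Type*} [Fintype m] [DecidableEq m] [Fintype n]
    (A : Matrix m n ℂ) (e : m ≃ n) :
    (A * Aᴴ).det = Complex.normSq (A.submatrix id e).det := by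
  have h : A * Aᴴ = A.submatrix id e * (A.submatrix id e)ᴴ := by
    rw [conjTranspose_submatrix, submatrix_mul_equiv]
    simp
  rw [h, det_mul, det_conjTranspose, ← Complex.mul_conj]
  rfl

end Matrix

/-! ### The incidence matrix and the expansion over square substructures. -/

namespace MixedGraph

open Finset

variable {V : Type*} {G : MixedGraph V}

open Classical in
/-- The entry of the incidence matrix of `G` at `v` and `e`: heads of oriented edges get `-i`, all
other end points get `1`. -/
noncomputable def inc (G : MixedGraph V) (v : V) (e : Sym2 V) : ℂ :=
  if v ∈ e then if ∃ u, e = s(u, v) ∧ G.arc u v then -Complex.I else 1 else 0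

theorem inc_of_notMem {v : V} {e : Sym2 V} (h : v ∉ e) : G.inc v e = 0 := if_neg h

theorem mem_of_inc_ne_zero {v : V} {e : Sym2 V} (h : G.inc v e ≠ 0) : v ∈ e := by
  by_contra hv
  exact h (inc_of_notMem hv)

open Classical in
theorem inc_right {u v : V} (h : u ≠ v) :
    G.inc v s(u, v) = if G.arc u v then -Complex.I else 1 := by
  have : (∃ w, s(u, v) = s(w, v) ∧ G.arc w v) ↔ G.arc u v := by
    constructor
    · rintro ⟨w, hw, ha⟩
      rw [Sym2.eq_iff] at hw
      rcases hw with ⟨rfl, -⟩ | ⟨rfl, -⟩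
      · exact ha
      · exact absurd rfl h
    · intro ha; exact ⟨u, rfl, ha⟩
  simp only [inc, Sym2.mem_mk_right, if_true, this]

theorem normSq_inc {v : V} {e : Sym2 V} (h : v ∈ e) : Complex.normSq (G.inc v e) = 1 := by
  unfold inc
  rw [if_pos h]
  split_ifs <;> simp

theorem inc_mul_conj {v : V} {e : Sym2 V} (h : v ∈ e) :
    G.inc v e * starRingEnd ℂ (G.inc v e) = 1 := by
  rw [Complex.mul_conj, normSq_inc h, Complex.ofReal_one]

theorem conj_inc_mul {v : V} {e : Sym2 V} (h : v ∈ e) :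
    starRingEnd ℂ (G.inc v e) * G.inc v e = 1 := by
  rw [mul_comm, inc_mul_conj h]

theorem inc_mul_conj_inc {u v : V} (h : G.graph.Adj u v) :
    G.inc u s(u, v) * starRingEnd ℂ (G.inc v s(u, v)) = G.hermitianAdjacency u v := by
  rw [inc_right h.ne, Sym2.eq_swap, inc_right h.ne.symm, hermitianAdjacency, Matrix.of_apply]
  have h1 := G.arc_asymm u v
  by_cases huv : G.arc u v <;> by_cases hvu : G.arc v u <;> simp_all

theorem hermitianAdjacency_of_not_adj {u v : V} (h : ¬ G.graph.Adj u v) :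
    G.hermitianAdjacency u v = 0 := by
  have h1 : ¬ G.arc u v := fun ha => h (G.adj_of_arc _ _ ha)
  have h2 : ¬ G.arc v u := fun ha => h (G.adj_of_arc _ _ ha).symm
  simp [hermitianAdjacency, h, h1, h2]

/-- The factorization `Q_H = N Nᴴ`: on the diagonal each incident edge adds 1, and off the diagonal
only the edge joining the two vertices can contribute. -/
theorem quasiLaplacian_apply [Fintype V] [Fintype G.graph.edgeSet] (u v : V) :
    G.quasiLaplacian u v =
      ∑ e : G.graph.edgeSet, G.inc u e * starRingEnd ℂ (G.inc v e) := by
  classical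
  rw [quasiLaplacian, Matrix.add_apply, degreeMatrix]
  by_cases huv : u = v
  · subst huv
    rw [Matrix.diagonal_apply_eq, hermitianAdjacency_of_not_adj (G.graph.irrefl), add_zero,
      ← SimpleGraph.card_incidenceFinset_eq_degree, SimpleGraph.incidenceFinset_eq_filter,
      Finset.card_filter, Nat.cast_sum,
      Finset.sum_subtype G.graph.edgeFinset (p := fun e => e ∈ G.graph.edgeSet) (by simp)]
    refine Fintype.sum_congr _ _ fun e => ?_
    by_cases he : u ∈ (e : Sym2 V)
    · simp [he, inc_mul_conj he]
    · simp [he, inc_of_notMem he]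
  · rw [Matrix.diagonal_apply_ne _ huv, zero_add]
    by_cases h : G.graph.Adj u v
    · rw [Fintype.sum_eq_single (⟨s(u, v), h⟩ : G.graph.edgeSet), inc_mul_conj_inc h]
      rintro ⟨e, he⟩ hne
      by_contra h0
      have h1 := mem_of_inc_ne_zero (left_ne_zero_of_mul h0)
      have h2 := mem_of_inc_ne_zero (v := v) (e := e) (by
        intro h3
        rw [h3, map_zero, mul_zero] at h0
        exact h0 rfl)
      exact hne (Subtype.ext ((Sym2.mem_and_mem_iff huv).1 ⟨h1, h2⟩))
    · rw [hermitianAdjacency_of_not_adj h, eq_comm]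
      refine Finset.sum_eq_zero fun e _ => ?_
      obtain ⟨e, he⟩ := e
      by_contra h0
      have h1 := mem_of_inc_ne_zero (left_ne_zero_of_mul h0)
      have h2 := mem_of_inc_ne_zero (v := v) (e := e) (by
        intro h3
        rw [h3, map_zero, mul_zero] at h0
        exact h0 rfl)
      have := (Sym2.mem_and_mem_iff huv).1 ⟨h1, h2⟩
      subst this
      exact h he

namespace Substructure

/-- The incidence matrix of a substructure. -/
noncomputable def incMatrix (R : G.Substructure) : Matrix R.verts R.edges ℂ :=
  Matrix.of fun v e => G.inc v e

/-- The determinant of the product of the incidence matrix of a substructure with its conjugate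
transpose. -/
noncomputable def gramDet (R : G.Substructure) : ℂ := by
  classical
  exact (R.incMatrix * R.incMatrix.conjTranspose).det

theorem gramDet_eq [DecidableEq V] (R : G.Substructure) :
    R.gramDet = (R.incMatrix * R.incMatrix.conjTranspose).det := by
  unfold gramDet
  congr!

theorem gramDet_eq_zero_of_card_lt (R : G.Substructure) (h : R.edges.card < R.verts.card) :
    R.gramDet = 0 := by
  classical
  rw [gramDet_eq]
  exact Matrix.det_mul_eq_zero_of_card_lt _ _ (by simpa using h)

end Substructure

-- Cauchy–Binet for the rows `W` of N. Keeping Gram determinants avoids choosing a bijection between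
-- `W` and each edge set.
open Classical in
theorem det_quasiLaplacian_submatrix [Fintype V] [DecidableEq V] (G : MixedGraph V)
    (W : Finset V) :
    (G.quasiLaplacian.submatrix (fun w : W => (w : V)) (fun w : W => (w : V))).det =
      ∑ R : G.Substructure with R.IsSquare ∧ R.verts = W, R.gramDet := by
  let A : Matrix W G.graph.edgeSet ℂ := Matrix.of fun w e => G.inc w e
  have hA : G.quasiLaplacian.submatrix (fun w : W => (w : V)) (fun w : W => (w : V)) =
      A * A.conjTranspose := by
    ext u v
    simp [quasiLaplacian_apply, Matrix.mul_apply, A]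
  rw [hA, Matrix.det_mul_eq_sum_powersetCard]
  let toSub : Finset G.graph.edgeSet → G.Substructure := fun s =>
    ⟨W, s.map (Function.Embedding.subtype _), fun e he => by
      obtain ⟨e', -, rfl⟩ := Finset.mem_map.1 he
      exact e'.2⟩
  refine Finset.sum_bij' (fun s _ => toSub s)
    (fun R _ => univ.filter fun e : G.graph.edgeSet => (e : Sym2 V) ∈ R.edges) ?_ ?_ ?_ ?_ ?_
  · intro s hs
    have := (mem_powersetCard.1 hs).2
    refine mem_filter.2 ⟨mem_univ _, ?_, rfl⟩
    simp [toSub, Substructure.IsSquare, this]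
  · intro R hR
    simp only [mem_filter, mem_univ, true_and] at hR
    obtain ⟨h1, rfl⟩ := hR
    rw [mem_powersetCard]
    refine ⟨subset_univ _, ?_⟩
    rw [Fintype.card_coe, h1, ← Finset.card_map (Function.Embedding.subtype _)]
    congr 1
    ext e
    simp only [mem_map, mem_filter, mem_univ, true_and, Function.Embedding.subtype_apply,
      Subtype.exists, exists_and_left, exists_prop, exists_eq_right_right]
    exact ⟨fun h => h.1, fun h => ⟨h, R.edges_subset _ h⟩⟩
  · intro s _
    ext e
    simp [toSub]
  · intro R hR
    simp only [mem_filter, mem_univ, true_and] at hR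
    obtain ⟨h1, rfl⟩ := hR
    ext e
    · simp [toSub]
    · simp only [toSub, mem_map, mem_filter, mem_univ, true_and, Function.Embedding.subtype_apply,
        Subtype.exists, exists_and_left, exists_prop, exists_eq_right_right]
      exact ⟨fun h => h.1, fun h => ⟨h, R.edges_subset _ h⟩⟩
  · intro s _
    rw [Substructure.gramDet_eq]
    congr 1
    ext u v
    simp only [Matrix.mul_apply, Matrix.submatrix_apply, Matrix.conjTranspose_apply, id,
      Substructure.incMatrix, Matrix.of_apply, A]
    rw [Finset.sum_coe_sort s fun e => G.inc u e * star (G.inc v e),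
      Finset.sum_coe_sort (toSub s).edges fun e => G.inc u e * star (G.inc v e)]
    simp [toSub]

end MixedGraph

/-! ### Parent maps and deletion of cycle edges. -/

namespace SimpleGraph

/-- In a connected graph every vertex other than the root has a neighbour closer to the root. -/
theorem Connected.exists_parent {X : Type*} {H : SimpleGraph X} (hH : H.Connected) (r : X) :
    ∃ f : X → X, ∀ v, v ≠ r → H.Adj v (f v) ∧ H.dist r (f v) < H.dist r v := by
  have : ∀ v, ∃ w, v ≠ r → H.Adj v w ∧ H.dist r w < H.dist r v := by
    intro v
    by_cases hv : v = r
    · exact ⟨v, fun h => absurd hv h⟩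
    · obtain ⟨p, hp⟩ := hH.exists_walk_length_eq_dist v r
      cases p with
      | nil => exact absurd rfl hv
      | cons h q =>
        refine ⟨_, fun _ => ⟨h, ?_⟩⟩
        rw [dist_comm, dist_comm (u := r), ← hp, Walk.length_cons]
        exact Nat.lt_succ_of_le (dist_le q)
  choose f hf using this
  exact ⟨f, hf⟩

theorem card_edgeSet_deleteEdges {X : Type*} [Finite X] {H : SimpleGraph X} {e : Sym2 X}
    (he : e ∈ H.edgeSet) :
    Nat.card (H.deleteEdges {e}).edgeSet + 1 = Nat.card H.edgeSet := by
  rw [edgeSet_deleteEdges, Nat.card_coe_set_eq, Nat.card_coe_set_eq,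
    Set.ncard_sdiff_singleton_add_one he]

theorem Connected.deleteEdges_of_mem_cycle {X : Type*} {H : SimpleGraph X} (hH : H.Connected)
    {u : X} {p : H.Walk u u} (hp : p.IsCycle) {e : Sym2 X} (he : e ∈ p.edges) :
    (H.deleteEdges {e}).Connected := by
  have hbr : ¬ H.IsBridge e := fun hb =>
    (isBridge_iff_forall_cycle_notMem (p.edges_subset_edgeSet he)).1 hb p hp he
  induction e with
  | _ a b => exact hH.connected_delete_edge_of_not_isBridge hbr

end SimpleGraph

/-! ### Gram determinants of rootless trees and unicyclic graphs. -/

namespace MixedGraph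

open Finset

variable {V : Type*} {G : MixedGraph V}

theorem normSq_hermitianAdjacency {u v : V} (h : G.graph.Adj u v) :
    Complex.normSq (G.hermitianAdjacency u v) = 1 := by
  rw [← inc_mul_conj_inc h, Complex.normSq_mul, Complex.normSq_conj,
    normSq_inc (Sym2.mem_mk_left _ _), normSq_inc (Sym2.mem_mk_right _ _), one_mul]

namespace Substructure

variable {R : G.Substructure}

theorem adj_of_underlying_adj {u v : R.verts} (h : R.underlying.Adj u v) :
    G.graph.Adj (u : V) v :=
  R.edges_subset _ h

/-- The product of the negated entries of the Hermitian adjacency matrix along a walk. -/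
noncomputable def negWeight {u v : R.verts} (p : R.underlying.Walk u v) : ℂ :=
  (p.darts.map fun d => -G.hermitianAdjacency (d.fst : V) (d.snd : V)).prod

theorem negWeight_cons {u v w : R.verts} (h : R.underlying.Adj u v) (p : R.underlying.Walk v w) :
    negWeight (.cons h p) = -G.hermitianAdjacency (u : V) (v : V) * negWeight p := by
  simp [negWeight]

theorem normSq_negWeight {u v : R.verts} (p : R.underlying.Walk u v) :
    Complex.normSq (negWeight p) = 1 := by
  induction p with
  | nil => simp [negWeight]
  | cons h p ih =>
    rw [negWeight_cons, Complex.normSq_mul, ih, Complex.normSq_neg,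
      normSq_hermitianAdjacency (adj_of_underlying_adj h), one_mul]

theorem gramDet_eq_normSq [DecidableEq V] (R : G.Substructure) (e : R.verts ≃ R.edges) :
    R.gramDet = Complex.normSq (R.incMatrix.submatrix id e).det := by
  rw [gramDet_eq, Matrix.det_mul_conjTranspose_eq_normSq _ e]

/-- Deleting the root of a connected substructure leaves an incidence matrix whose determinant has
modulus one, if that matrix is square. -/
theorem gramDet_eq_one_of_connected {T : G.Substructure} (hT : T.underlying.Connected) {r : V}
    (hr : r ∈ T.verts) (hv : ∀ v, v ∈ R.verts ↔ v ∈ T.verts ∧ v ≠ r) (he : R.edges = T.edges)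
    (hsq : R.IsSquare) : R.gramDet = 1 := by
  classical
  obtain ⟨f, hf⟩ := hT.exists_parent ⟨r, hr⟩
  let ι : R.verts → T.verts := fun v => ⟨v, ((hv v).1 v.2).1⟩
  have hι : ∀ v, ι v ≠ ⟨r, hr⟩ := fun v h => ((hv v).1 v.2).2 (congrArg Subtype.val h)
  -- Each vertex is paired with its edge towards the root. Two vertices sharing an edge would each
  -- be closer to the root than the other.
  let π : R.verts → R.edges := fun v => ⟨s((v : V), (f (ι v) : V)), by
    rw [he]; exact (hf (ι v) (hι v)).1⟩
  have hπ : Function.Injective π := by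
    intro v w hvw
    have h1 : s((v : V), (f (ι v) : V)) = s((w : V), (f (ι w) : V)) := congrArg Subtype.val hvw
    rw [Sym2.eq_iff] at h1
    rcases h1 with ⟨h1, -⟩ | ⟨h1, h2⟩
    · exact Subtype.ext h1
    · have h3 : ι v = f (ι w) := Subtype.ext h1
      have h4 : f (ι v) = ι w := Subtype.ext h2
      have h5 := (hf (ι v) (hι v)).2
      have h6 := (hf (ι w) (hι w)).2
      rw [h4] at h5
      rw [← h3] at h6
      exact absurd h5 h6.asymm
  have hb : Function.Bijective π :=
    (Fintype.bijective_iff_injective_and_card _).2 ⟨hπ, by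
      simpa using (show R.verts.card = R.edges.card from hsq)⟩
  rw [gramDet_eq_normSq R (Equiv.ofBijective π hb),
    Matrix.det_eq_prod_diag_of_rank _ (fun v => T.underlying.dist ⟨r, hr⟩ (ι v))]
  · rw [map_prod]
    rw [Finset.prod_eq_one, Complex.ofReal_one]
    intro v _
    exact normSq_inc (Sym2.mem_mk_left _ _)
  · intro u v huv h
    have hm : (u : V) ∈ s((v : V), (f (ι v) : V)) := mem_of_inc_ne_zero h
    rw [Sym2.mem_iff] at hm
    rcases hm with hm | hm
    · exact absurd (Subtype.ext hm) huv
    · have : ι u = f (ι v) := Subtype.ext hm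
      rw [this]
      exact (hf (ι v) (hι v)).2

theorem sum_mul_inc [DecidableEq V] (φ : R.verts → ℂ) {a b : R.verts} (h : a ≠ b) :
    ∑ w : R.verts, φ w * G.inc w s((a : V), (b : V)) =
      φ a * G.inc a s((a : V), (b : V)) + φ b * G.inc b s((a : V), (b : V)) := by
  refine Fintype.sum_eq_add a b h fun w hw => ?_
  rw [inc_of_notMem, mul_zero]
  rw [Sym2.mem_iff]
  rintro (hm | hm)
  · exact hw.1 (Subtype.ext hm)
  · exact hw.2 (Subtype.ext hm)

/-- If `φ` is orthogonal to the column of an edge, then its values at the two ends of that edge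
determine each other. -/
theorem eq_neg_mul_of_sum_eq_zero [DecidableEq V] {φ : R.verts → ℂ} {a b : R.verts}
    (hab : R.underlying.Adj a b)
    (h : ∑ w : R.verts, φ w * G.inc w s((a : V), (b : V)) = 0) :
    φ b = φ a * -G.hermitianAdjacency (a : V) (b : V) := by
  rw [sum_mul_inc φ hab.ne] at h
  rw [← inc_mul_conj_inc (adj_of_underlying_adj hab)]
  have h2 := inc_mul_conj (G := G) (Sym2.mem_mk_right (a : V) (b : V))
  linear_combination (starRingEnd ℂ (G.inc b s((a : V), (b : V)))) * h - φ b * h2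

/-- The edge `e` is exempt because the null vector used for a cycle is orthogonal to every column
except that of one cycle edge. -/
theorem eq_mul_negWeight [DecidableEq V] {φ : R.verts → ℂ} {e : Sym2 R.verts}
    (hφ : ∀ a b, R.underlying.Adj a b → s(a, b) ≠ e →
      φ b = φ a * -G.hermitianAdjacency (a : V) (b : V))
    {u v : R.verts} (p : R.underlying.Walk u v) (hp : e ∉ p.edges) :
    φ v = φ u * negWeight p := by
  induction p with
  | nil => simp [negWeight]
  | cons h p ih =>
    rw [SimpleGraph.Walk.edges_cons, List.mem_cons, not_or] at hp
    rw [ih hp.2, negWeight_cons, hφ _ _ h (Ne.symm hp.1), mul_assoc]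

/-- Cut the cycle at `uv`. A vector `φ` orthogonal to all other columns is transported along edges
by -h, and its failure to close up around the cycle is 1 - w. Replacing row `u` by the
`φ`-combination of all rows leaves a triangular matrix whose only diagonal entry not of modulus 1
carries this factor. -/
theorem gramDet_of_isCycle (hR : R.underlying.Connected) (hsq : R.IsSquare) {u : R.verts}
    (p : R.underlying.Walk u u) (hp : p.IsCycle) :
    R.gramDet = Complex.normSq (1 - negWeight p) := by
  classical
  cases p with
  | nil => exact absurd rfl hp.ne_nil
  | @cons _ v _ huv q =>
  have hq : s(u, v) ∉ q.edges := ((SimpleGraph.Walk.cons_isCycle_iff q huv).1 hp).2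
  have hH : (R.underlying.deleteEdges {s(u, v)}).Connected :=
    hR.deleteEdges_of_mem_cycle hp (by simp)
  set H := R.underlying.deleteEdges {s(u, v)} with hHdef
  have hHle : ∀ {a b}, H.Adj a b → R.underlying.Adj a b ∧ s(a, b) ≠ s(u, v) := by
    intro a b hab
    rw [hHdef, SimpleGraph.deleteEdges_adj] at hab
    simpa using hab
  have hinj : Function.Injective (Sym2.map (Subtype.val : R.verts → V)) :=
    Sym2.map.injective Subtype.val_injective
  obtain ⟨f, hf⟩ := hH.exists_parent u
  -- Each vertex other than `u` gets its parent edge; `u` gets the edge that was cut.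
  let σ : R.verts → Sym2 R.verts := fun x => if x = u then s(u, v) else s(x, f x)
  have hσu : σ u = s(u, v) := if_pos rfl
  have hσ : ∀ {x}, x ≠ u → σ x = s(x, f x) := fun hx => if_neg hx
  have hσne : ∀ {x}, x ≠ u → σ x ≠ s(u, v) := fun hx => by
    rw [hσ hx]; exact (hHle (hf _ hx).1).2
  have hσmem : ∀ x, Sym2.map Subtype.val (σ x) ∈ R.edges := by
    intro x
    by_cases hx : x = u
    · subst hx; rw [hσu]; exact huv
    · rw [hσ hx]; exact (hHle (hf _ hx).1).1
  have hσinj : Function.Injective σ := by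
    intro x y hxy
    by_cases hx : x = u
    · by_contra hne
      have hy : y ≠ u := fun h => hne (hx.trans h.symm)
      subst hx
      exact hσne hy (hxy.symm.trans hσu)
    · by_cases hy : y = u
      · subst hy; exact absurd (hxy.trans hσu) (hσne hx)
      · rw [hσ hx, hσ hy, Sym2.eq_iff] at hxy
        rcases hxy with ⟨h, -⟩ | ⟨h1, h2⟩
        · exact h
        · have h5 := (hf x hx).2
          have h6 := (hf y hy).2
          rw [h2] at h5
          rw [← h1] at h6
          exact absurd h5 h6.asymm
  let π : R.verts → R.edges := fun x => ⟨Sym2.map Subtype.val (σ x), hσmem x⟩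
  have hb : Function.Bijective π :=
    (Fintype.bijective_iff_injective_and_card _).2
      ⟨fun x y h => hσinj (hinj (congrArg Subtype.val h)), by
      simpa using (show R.verts.card = R.edges.card from hsq)⟩
  set M := R.incMatrix.submatrix id (Equiv.ofBijective π hb) with hM
  have hMa : ∀ w x, M w x = G.inc w (Sym2.map Subtype.val (σ x)) := fun w x => rfl
  -- Zeroing the column of `uv` forces a left null vector, with no condition imposed at that edge.
  have hM0 : (M.updateCol u 0).det = 0 :=
    Matrix.det_eq_zero_of_column_eq_zero u fun i => by simp
  obtain ⟨φ, hφ0, hφ⟩ := Matrix.exists_vecMul_eq_zero_iff.2 hM0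
  have hcol : ∀ x, x ≠ u → ∑ w, φ w * M w x = 0 := by
    intro x hx
    have := congrFun hφ x
    simpa [Matrix.vecMul, dotProduct, Matrix.updateCol_apply, hx] using this
  have hstep : ∀ a b, R.underlying.Adj a b → s(a, b) ≠ s(u, v) →
      φ b = φ a * -G.hermitianAdjacency (a : V) (b : V) := by
    intro a b hab hne
    apply eq_neg_mul_of_sum_eq_zero hab
    obtain ⟨x, hx⟩ := hb.2 ⟨s((a : V), (b : V)), hab⟩
    have hx' : σ x = s(a, b) := hinj (congrArg Subtype.val hx)
    have hxu : x ≠ u := by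
      rintro rfl
      exact hne (hx'.symm.trans hσu)
    have := hcol x hxu
    simpa [hMa, hx'] using this
  -- Transport multiplies by numbers of modulus 1, so a nonzero value anywhere spreads to `u`.
  have hφu : φ u ≠ 0 := by
    obtain ⟨w, hw⟩ := Function.ne_iff.1 hφ0
    obtain ⟨q⟩ := hH.preconnected w u
    have key : ∀ {x y} (_ : H.Walk x y), φ x ≠ 0 → φ y ≠ 0 := by
      intro x y q
      induction q with
      | nil => exact id
      | cons h q ih =>
        intro hx
        refine ih ?_
        have := hHle h
        rw [hstep _ _ this.1 this.2]
        refine mul_ne_zero hx (neg_ne_zero.2 ?_)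
        rw [← Complex.normSq_pos, normSq_hermitianAdjacency (adj_of_underlying_adj this.1)]
        exact one_pos
    exact key q hw
  have hφuv : φ u = φ v * negWeight q := eq_mul_negWeight hstep q hq
  set M' := M.updateRow u (∑ k, φ k • M k) with hM'
  have hdet : M'.det = φ u * M.det := by
    rw [hM', Matrix.det_updateRow_sum, smul_eq_mul]
  have hM'u : ∀ x, M' u x = ∑ w, φ w * M w x := by
    intro x
    rw [hM', Matrix.updateRow_self, Finset.sum_apply]
    rfl
  have hM'ne : ∀ w x, w ≠ u → M' w x = M w x := by
    intro w x hw
    rw [hM', Matrix.updateRow_ne hw]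
  have hdiag : M'.det = ∏ x, M' x x := by
    refine Matrix.det_eq_prod_diag_of_rank M'
      -- The root is ranked last: its new row vanishes off the diagonal, while its column is
      -- arbitrary.
      (fun x => if x = u then (⊤ : ℕ∞) else (H.dist u x : ℕ∞)) ?_
    intro w x hwx h
    by_cases hw : w = u
    · subst hw
      rw [hM'u, hcol x hwx.symm] at h
      exact absurd rfl h
    · rw [if_neg hw]
      by_cases hx : x = u
      · rw [if_pos hx]
        exact ENat.natCast_lt_top _
      · rw [if_neg hx]
        rw [hM'ne w x hw, hMa, hσ hx] at h
        have hm := mem_of_inc_ne_zero h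
        rw [Sym2.map_mk, Sym2.mem_iff] at hm
        rcases hm with hm | hm
        · exact absurd (Subtype.ext hm) hwx
        · have : w = f x := Subtype.ext hm
          rw [this]
          exact_mod_cast (hf x hx).2
  have hprod : Complex.normSq (∏ x, M' x x) = Complex.normSq (M' u u) := by
    rw [map_prod]
    refine Finset.prod_eq_single u (fun x _ hx => ?_) (by simp)
    rw [hM'ne x x hx, hMa, hσ hx]
    exact normSq_inc (by simp)
  have ht : Complex.normSq (M' u u) =
      Complex.normSq (φ v) * Complex.normSq (1 - negWeight (.cons huv q)) := by
    have h1 : M' u u = φ u * G.inc u s((u : V), (v : V)) + φ v * G.inc v s((u : V), (v : V)) := by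
      rw [hM'u, ← sum_mul_inc φ huv.ne]
      simp [hMa, hσu]
    have h2 := conj_inc_mul (G := G) (Sym2.mem_mk_right (u : V) (v : V))
    have h3 : M' u u = φ v * (1 - negWeight (.cons huv q)) * G.inc v s((u : V), (v : V)) := by
      rw [h1, negWeight_cons, ← inc_mul_conj_inc (adj_of_underlying_adj huv), hφuv]
      linear_combination (-φ v * negWeight q * G.inc u s((u : V), (v : V))) * h2
    rw [h3, Complex.normSq_mul, Complex.normSq_mul, normSq_inc (Sym2.mem_mk_right _ _), mul_one]
  have hφn : Complex.normSq (φ v) = Complex.normSq (φ u) := by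
    rw [hφuv, Complex.normSq_mul, normSq_negWeight, mul_one]
  rw [gramDet_eq_normSq R (Equiv.ofBijective π hb), ← hM]
  have hfin := congrArg Complex.normSq (hdet.symm.trans hdiag)
  rw [hprod, ht, Complex.normSq_mul, hφn] at hfin
  have hpos : Complex.normSq (φ u) ≠ 0 := by rwa [Ne, Complex.normSq_eq_zero]
  rw [mul_left_cancel₀ hpos hfin]

/-! ### Weights of the three cycle types. -/

/-- The weight of a closed walk in terms of the numbers of its edges of each kind. -/
theorem negWeight_eq {u v : R.verts} (p : R.underlying.Walk u v) :
    negWeight p = (-Complex.I) ^ numForward p * Complex.I ^ numBackward p *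
      (-1) ^ numUnoriented p := by
  classical
  induction p with
  | nil => simp [negWeight, numForward, numBackward, numUnoriented]
  | @cons u v w h p ih =>
    rw [negWeight_cons, ih]
    have h1 := G.arc_asymm u v
    have h2 := adj_of_underlying_adj h
    simp only [numForward, numBackward, numUnoriented, SimpleGraph.Walk.darts_cons,
      List.countP_cons, hermitianAdjacency, Matrix.of_apply, h2, if_true]
    by_cases huv : G.arc u v <;> by_cases hvu : G.arc v u
    · exact absurd hvu (h1 huv)
    · simp [huv, hvu, pow_succ]; ring
    · simp [huv, hvu, pow_succ]; ring
    · simp [huv, hvu, pow_succ]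

theorem negWeight_eq_zpow {u v : R.verts} (p : R.underlying.Walk u v) :
    negWeight p = Complex.I ^
      ((numBackward p : ℤ) - numForward p + 2 * numUnoriented p) := by
  rw [negWeight_eq, zpow_add₀ Complex.I_ne_zero, zpow_sub₀ Complex.I_ne_zero, zpow_mul]
  simp only [zpow_natCast, div_eq_mul_inv, ← inv_pow, Complex.inv_I]
  norm_num
  ring

theorem normSq_of_isTypeI {u : R.verts} (p : R.underlying.Walk u u) (h : IsTypeI p) :
    Complex.normSq (1 - negWeight p) = 2 := by
  have hodd : Odd ((numBackward p : ℤ) - numForward p + 2 * numUnoriented p) := by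
    obtain ⟨k, hk⟩ := h
    exact ⟨k - numForward p + numUnoriented p, by omega⟩
  obtain ⟨k, hk⟩ := hodd
  have h1 : negWeight p = (-1) ^ k * Complex.I := by
    rw [negWeight_eq_zpow, hk, zpow_add₀ Complex.I_ne_zero, zpow_mul]
    norm_num
  rcases Int.even_or_odd k with hk | hk
  · rw [h1, hk.neg_one_zpow, Complex.normSq_apply]; norm_num
  · rw [h1, hk.neg_one_zpow, Complex.normSq_apply]; norm_num

/-- The exponent b - a + 2c of i is 2k or 2k - 2|a - b|. Since |a - b| is even, these agree modulo
4. -/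
theorem negWeight_eq_neg_one_zpow {u : R.verts} (p : R.underlying.Walk u u) {k : ℤ}
    (h : |(numForward p : ℚ) - (numBackward p : ℚ)| / 2 + (numUnoriented p : ℚ) = (k : ℚ)) :
    negWeight p = (-1) ^ k := by
  have h' : |(numForward p : ℤ) - (numBackward p : ℤ)| + 2 * numUnoriented p = 2 * k := by
    have : (|(numForward p : ℚ) - (numBackward p : ℚ)| + 2 * numUnoriented p : ℚ) = 2 * k := by
      linarith
    exact_mod_cast this
  rw [negWeight_eq_zpow]
  rcases abs_cases ((numForward p : ℤ) - (numBackward p : ℤ)) with ⟨h1, -⟩ | ⟨h1, -⟩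
  · have : (numBackward p : ℤ) - numForward p + 2 * numUnoriented p =
        2 * (k - (numForward p - numBackward p)) := by omega
    have h2 : (numForward p : ℤ) - numBackward p = 2 * (k - numUnoriented p) := by omega
    rw [this, h2, zpow_mul, zpow_sub₀ (by norm_num), zpow_mul]
    norm_num
  · have : (numBackward p : ℤ) - numForward p + 2 * numUnoriented p = 2 * k := by omega
    rw [this, zpow_mul]
    norm_num

theorem normSq_of_isTypeII {u : R.verts} (p : R.underlying.Walk u u) (h : IsTypeII p) :
    Complex.normSq (1 - negWeight p) = 4 := by
  obtain ⟨k, hk, h⟩ := h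
  rw [negWeight_eq_neg_one_zpow p h, hk.neg_one_zpow, Complex.normSq_apply]
  norm_num

theorem normSq_of_isTypeIII {u : R.verts} (p : R.underlying.Walk u u) (h : IsTypeIII p) :
    Complex.normSq (1 - negWeight p) = 0 := by
  obtain ⟨k, hk, h⟩ := h
  rw [negWeight_eq_neg_one_zpow p h, hk.neg_one_zpow, sub_self, map_zero]

theorem isType_cases {u : R.verts} (p : R.underlying.Walk u u) :
    IsTypeI p ∨ IsTypeII p ∨ IsTypeIII p := by
  by_cases h : IsTypeI p
  · exact .inl h
  · have h1 : Even ((numForward p : ℤ) - numBackward p) := by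
      obtain ⟨k, hk⟩ := Nat.not_odd_iff_even.1 h
      exact ⟨k - numBackward p, by omega⟩
    obtain ⟨k, hk⟩ := (even_abs.2 h1)
    have h2 : |(numForward p : ℚ) - (numBackward p : ℚ)| / 2 + (numUnoriented p : ℚ) =
        ((k + numUnoriented p : ℤ) : ℚ) := by
      have : |(numForward p : ℚ) - (numBackward p : ℚ)| = k + k := by exact_mod_cast hk
      rw [this]
      push_cast
      ring
    rcases Int.even_or_odd (k + numUnoriented p) with h3 | h3
    · exact .inr (.inr ⟨_, h3, h2⟩)
    · exact .inr (.inl ⟨_, h3, h2⟩)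

end Substructure

end MixedGraph

/-! ### Closures and connectedness of components. -/

namespace MixedGraph

open Finset

variable {V : Type*} {G : MixedGraph V}

namespace Substructure

variable {R : G.Substructure}

open Classical in
/-- The substructure obtained by adding all end points of the edges. -/
noncomputable def closure (R : G.Substructure) : G.Substructure where
  verts := R.verts ∪ R.edges.biUnion fun e => e.toFinset
  edges := R.edges
  edges_subset := R.edges_subset

theorem mem_closure_verts {v : V} :
    v ∈ R.closure.verts ↔ v ∈ R.verts ∨ ∃ e ∈ R.edges, v ∈ e := by
  classical
  simp [closure]

theorem closure_isGraph (R : G.Substructure) : R.closure.IsGraph :=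
  fun e he _ hv => mem_closure_verts.2 (.inr ⟨e, he, hv⟩)

theorem IsGraph.closure_eq (h : R.IsGraph) : R.closure = R := by
  ext v
  · rw [mem_closure_verts]
    exact ⟨fun hv => hv.elim id fun ⟨e, he, hv⟩ => h e he v hv, .inl⟩
  · rfl

theorem IsGraph.card_edgeSet (h : R.IsGraph) :
    Nat.card R.underlying.edgeSet = R.edges.card := by
  have hf : Function.Bijective (fun e : R.underlying.edgeSet =>
      (⟨Sym2.map Subtype.val e.1, by
        obtain ⟨e, he⟩ := e
        induction e with
        | _ a b => exact he⟩ : R.edges)) := by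
    constructor
    · intro e f hef
      exact Subtype.ext (Sym2.map.injective Subtype.val_injective (congrArg Subtype.val hef))
    · rintro ⟨e, he⟩
      induction e with
      | _ a b =>
        exact ⟨⟨s(⟨a, h _ he a (Sym2.mem_mk_left a b)⟩, ⟨b, h _ he b (Sym2.mem_mk_right a b)⟩), he⟩,
          rfl⟩
  rw [Nat.card_eq_of_bijective _ hf, Nat.card_eq_fintype_card, Fintype.card_coe]

theorem mem_component_verts {c : R.incidence.ConnectedComponent} {v : V} :
    v ∈ (R.component c).verts ↔
      ∃ h : v ∈ R.verts, R.incidence.connectedComponentMk (Sum.inl ⟨v, h⟩) = c := by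
  simp only [component, mem_filter, and_iff_right_iff_imp]
  exact fun h => h.1

theorem mem_component_edges {c : R.incidence.ConnectedComponent} {e : Sym2 V} :
    e ∈ (R.component c).edges ↔
      ∃ h : e ∈ R.edges, R.incidence.connectedComponentMk (Sum.inr ⟨e, h⟩) = c := by
  simp only [component, mem_filter, and_iff_right_iff_imp]
  exact fun h => h.1

/-- The vertices at a node of the incidence graph. -/
def nodeVerts (R : G.Substructure) : R.verts ⊕ R.edges → Set V
  | .inl v => {(v : V)}
  | .inr e => {v | v ∈ (e : Sym2 V)}

theorem nodeVerts_nonempty (x : R.verts ⊕ R.edges) : (R.nodeVerts x).Nonempty := by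
  rcases x with v | ⟨e, he⟩
  · exact ⟨v, rfl⟩
  · induction e with
    | _ a b => exact ⟨a, Sym2.mem_mk_left a b⟩

theorem exists_mem_nodeVerts_of_adj {x y : R.verts ⊕ R.edges} (h : R.incidence.Adj x y) :
    ∃ v, v ∈ R.nodeVerts x ∧ v ∈ R.nodeVerts y := by
  rcases x with v | e <;> rcases y with w | f
  · exact h.elim
  · exact ⟨v, rfl, h⟩
  · exact ⟨w, h, rfl⟩
  · exact h.elim

theorem mem_closure_component {c : R.incidence.ConnectedComponent} {v : V} :
    v ∈ (R.component c).closure.verts ↔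
      ∃ x, R.incidence.connectedComponentMk x = c ∧ v ∈ R.nodeVerts x := by
  rw [mem_closure_verts, mem_component_verts]
  constructor
  · rintro (⟨h, hc⟩ | ⟨e, he, hv⟩)
    · exact ⟨_, hc, rfl⟩
    · obtain ⟨h, hc⟩ := mem_component_edges.1 he
      exact ⟨_, hc, hv⟩
  · rintro ⟨x | e, hx, hv⟩
    · left
      obtain rfl : v = x := hv
      exact ⟨x.2, hx⟩
    · exact .inr ⟨e, mem_component_edges.2 ⟨e.2, hx⟩, hv⟩

theorem reachable_of_mem_nodeVerts {c : R.incidence.ConnectedComponent}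
    {x : R.verts ⊕ R.edges} (hx : R.incidence.connectedComponentMk x = c)
    {v w : (R.component c).closure.verts} (hv : (v : V) ∈ R.nodeVerts x)
    (hw : (w : V) ∈ R.nodeVerts x) : (R.component c).closure.underlying.Reachable v w := by
  by_cases hvw : v = w
  · rw [hvw]
  · rcases x with u | e
    · exact absurd (Subtype.ext (Eq.trans hv (Eq.symm hw))) hvw
    · refine SimpleGraph.Adj.reachable ?_
      have he : (e : Sym2 V) = s((v : V), (w : V)) :=
        (Sym2.mem_and_mem_iff fun h => hvw (Subtype.ext h)).1 ⟨hv, hw⟩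
      change s((v : V), (w : V)) ∈ (R.component c).edges
      rw [← he]
      exact mem_component_edges.2 ⟨e.2, hx⟩

/-- Adjacent incidence nodes share a vertex, and vertices at one node are equal or joined by an
edge, so walks between nodes yield walks between vertices. -/
theorem closure_component_connected (c : R.incidence.ConnectedComponent) :
    (R.component c).closure.underlying.Connected := by
  have key : ∀ {x y} (_ : R.incidence.Walk x y), R.incidence.connectedComponentMk x = c →
      ∀ {v w : (R.component c).closure.verts}, (v : V) ∈ R.nodeVerts x → (w : V) ∈ R.nodeVerts y →
        (R.component c).closure.underlying.Reachable v w := by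
    intro x y p
    induction p with
    | nil => exact fun hx _ _ hv hw => reachable_of_mem_nodeVerts hx hv hw
    | cons h p ih =>
      intro hx v w hv hw
      obtain ⟨a, ha, ha'⟩ := exists_mem_nodeVerts_of_adj h
      have hz := (SimpleGraph.ConnectedComponent.sound h.symm.reachable).trans hx
      have hmem : a ∈ (R.component c).closure.verts := mem_closure_component.2 ⟨_, hx, ha⟩
      exact (reachable_of_mem_nodeVerts hx hv (w := ⟨a, hmem⟩) ha).trans (ih hz ha' hw)
  rw [SimpleGraph.connected_iff]
  constructor
  · intro v w
    obtain ⟨x, hx, hvx⟩ := mem_closure_component.1 v.2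
    obtain ⟨y, hy, hwy⟩ := mem_closure_component.1 w.2
    obtain ⟨p⟩ := SimpleGraph.ConnectedComponent.exact (hx.trans hy.symm)
    exact key p hx hvx hwy
  · induction c using SimpleGraph.ConnectedComponent.ind with
    | _ x =>
      obtain ⟨v, hv⟩ := nodeVerts_nonempty x
      exact ⟨⟨v, mem_closure_component.2 ⟨x, rfl, hv⟩⟩⟩

/-! ### Classification of square components by counting. -/

theorem isTree_iff : R.IsTree ↔
    R.IsGraph ∧ R.underlying.Connected ∧ R.edges.card + 1 = R.verts.card := by
  refine and_congr_right fun h => ?_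
  rw [SimpleGraph.isTree_iff_connected_and_card, h.card_edgeSet, Nat.card_eq_fintype_card,
    Fintype.card_coe]

theorem IsRootlessTree.isSquare (h : R.IsRootlessTree) : R.IsSquare := by
  classical
  obtain ⟨T, hT, r, hr, rfl⟩ := h
  have := (isTree_iff.1 hT).2.2
  have h2 := Finset.card_erase_of_mem hr
  have h3 : (T.verts.erase r).card = T.edges.card := by omega
  simp only [IsSquare, deleteVertex]
  convert h3

/-- A remaining vertex forces an edge at the deleted root. Nonemptiness matters: a one-vertex tree
without its root is empty, and trivially a graph. -/
theorem IsGraph.not_isRootlessTree (h : R.IsGraph) (hne : R.verts.Nonempty) :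
    ¬ R.IsRootlessTree := by
  classical
  rintro ⟨T, hT, r, hr, rfl⟩
  obtain ⟨v, hv⟩ := hne
  obtain ⟨hvr, hvT⟩ := Finset.mem_erase.1 hv
  obtain ⟨f, hf⟩ := hT.2.connected.exists_parent ⟨v, hvT⟩
  have hadj := (hf ⟨r, hr⟩ fun h => hvr (congrArg Subtype.val h).symm).1
  exact (Finset.mem_erase.1 (h _ hadj r (Sym2.mem_mk_left _ _))).1 rfl

/-- Deleting an edge of the unique cycle leaves a tree. Conversely, with equally many edges and
vertices, deleting an edge of any cycle leaves a tree, so every other cycle used that edge. -/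
theorem isUnicyclic_iff : R.IsUnicyclic ↔
    R.IsGraph ∧ R.underlying.Connected ∧ R.IsSquare := by
  classical
  refine and_congr_right fun hG => and_congr_right fun hC => ?_
  have hV : Nat.card R.verts = R.verts.card := by simp
  constructor
  · rintro ⟨u, p, hp, huniq⟩
    obtain ⟨e, he⟩ := List.exists_mem_of_ne_nil p.edges (by
      rw [Ne, SimpleGraph.Walk.edges_eq_nil]
      exact hp.not_nil)
    have hC' := hC.deleteEdges_of_mem_cycle hp he
    have hT : (R.underlying.deleteEdges {e}).IsTree := by
      refine ⟨hC', fun w q hq => ?_⟩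
      have hle : R.underlying.deleteEdges {e} ≤ R.underlying := SimpleGraph.deleteEdges_le _
      have h1 := (huniq w (q.mapLe hle) (hq.mapLe hle) e).2 he
      rw [SimpleGraph.Walk.edges_mapLe_eq_edges] at h1
      have h2 := q.edges_subset_edgeSet h1
      rw [SimpleGraph.edgeSet_deleteEdges] at h2
      exact h2.2 rfl
    have h1 := (SimpleGraph.isTree_iff_connected_and_card.1 hT).2
    rw [SimpleGraph.card_edgeSet_deleteEdges (p.edges_subset_edgeSet he), hG.card_edgeSet, hV] at h1
    exact h1.symm
  · intro hsq
    have hcyc : ∀ {u w} {p : R.underlying.Walk u u} {q : R.underlying.Walk w w}, p.IsCycle →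
        q.IsCycle → ∀ {e}, e ∈ p.edges → e ∈ q.edges := by
      intro u w p q hp hq e he
      by_contra heq
      have hT : (R.underlying.deleteEdges {e}).IsTree := by
        rw [SimpleGraph.isTree_iff_connected_and_card]
        refine ⟨hC.deleteEdges_of_mem_cycle hp he, ?_⟩
        rw [SimpleGraph.card_edgeSet_deleteEdges (p.edges_subset_edgeSet he), hG.card_edgeSet, hV]
        exact hsq.symm
      exact hT.isAcyclic _ (SimpleGraph.Walk.IsCycle.toDeleteEdges _ {e} hq fun e' he' (h : e' = e) => heq (h ▸ he'))
    have hna : ¬ R.underlying.IsAcyclic := by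
      intro hA
      have h1 := (SimpleGraph.isTree_iff_connected_and_card.1 ⟨hC, hA⟩).2
      rw [hG.card_edgeSet, hV, hsq] at h1
      omega
    simp only [SimpleGraph.IsAcyclic, not_forall, not_not] at hna
    obtain ⟨u, p, hp⟩ := hna
    exact ⟨u, p, hp, fun w q hq e => ⟨hcyc hq hp, hcyc hp hq⟩⟩

theorem gramDet_of_isUnicyclicI (h : R.IsUnicyclicI) : R.gramDet = 2 := by
  obtain ⟨hU, u, p, hp, hI⟩ := h
  obtain ⟨-, hC, hsq⟩ := isUnicyclic_iff.1 hU
  rw [gramDet_of_isCycle hC hsq p hp, normSq_of_isTypeI p hI]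
  norm_num

theorem gramDet_of_isUnicyclicII (h : R.IsUnicyclicII) : R.gramDet = 4 := by
  obtain ⟨hU, u, p, hp, hI⟩ := h
  obtain ⟨-, hC, hsq⟩ := isUnicyclic_iff.1 hU
  rw [gramDet_of_isCycle hC hsq p hp, normSq_of_isTypeII p hI]
  norm_num

theorem gramDet_of_isUnicyclicIII (h : R.IsUnicyclicIII) : R.gramDet = 0 := by
  obtain ⟨hU, u, p, hp, hI⟩ := h
  obtain ⟨-, hC, hsq⟩ := isUnicyclic_iff.1 hU
  rw [gramDet_of_isCycle hC hsq p hp, normSq_of_isTypeIII p hI]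
  norm_num

theorem IsUnicyclic.cases (h : R.IsUnicyclic) :
    R.IsUnicyclicI ∨ R.IsUnicyclicII ∨ R.IsUnicyclicIII := by
  obtain ⟨u, p, hp, -⟩ := h.2.2
  rcases isType_cases p with h1 | h1 | h1
  · exact .inl ⟨h, u, p, hp, h1⟩
  · exact .inr (.inl ⟨h, u, p, hp, h1⟩)
  · exact .inr (.inr ⟨h, u, p, hp, h1⟩)

/-- The condition on the components of a special square substructure. -/
def IsSpecialComponent (R : G.Substructure) : Prop :=
  R.IsRootlessTree ∨ (R.IsUnicyclic ∧ ¬ R.IsUnicyclicIII)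

theorem IsSpecialComponent.isSquare (h : R.IsSpecialComponent) : R.IsSquare :=
  h.elim (fun h => h.isSquare) fun h => (isUnicyclic_iff.1 h.1).2.2

open Classical in
theorem gramDet_of_closure_connected (hC : R.closure.underlying.Connected) (hsq : R.IsSquare) :
    R.gramDet = if R.IsSpecialComponent then
      2 ^ ((if R.IsUnicyclicI then 1 else 0) + 2 * (if R.IsUnicyclicII then 1 else 0))
      else 0 := by
  by_cases hG : R.IsGraph
  · rw [hG.closure_eq] at hC
    have hU : R.IsUnicyclic := isUnicyclic_iff.2 ⟨hG, hC, hsq⟩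
    have hne : R.verts.Nonempty := by
      obtain ⟨v⟩ := hC.nonempty
      exact ⟨v, v.2⟩
    have hsp : R.IsSpecialComponent ↔ ¬ R.IsUnicyclicIII := by
      simp [IsSpecialComponent, hG.not_isRootlessTree hne, hU]
    -- The distinct values 2, 4 and 0 also show that the three types exclude each other.
    have h1 := gramDet_of_isUnicyclicI (R := R)
    have h2 := gramDet_of_isUnicyclicII (R := R)
    have h3 := gramDet_of_isUnicyclicIII (R := R)
    rw [if_congr hsp rfl rfl]
    rcases hU.cases with h | h | h
    · have n2 : ¬ R.IsUnicyclicII := fun h' => by have := (h1 h).symm.trans (h2 h'); norm_num at this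
      have n3 : ¬ R.IsUnicyclicIII := fun h' => by
        have := (h1 h).symm.trans (h3 h'); norm_num at this
      simp [h1 h, h, n2, n3]
    · have n1 : ¬ R.IsUnicyclicI := fun h' => by have := (h2 h).symm.trans (h1 h'); norm_num at this
      have n3 : ¬ R.IsUnicyclicIII := fun h' => by
        have := (h2 h).symm.trans (h3 h'); norm_num at this
      rw [h2 h]
      simp only [h, n1, n3]
      norm_num
    · rw [h3 h, if_neg (not_not.2 h)]
  · have hsub : R.verts ⊆ R.closure.verts := fun v hv => mem_closure_verts.2 (.inl hv)
    have hex : ∃ r ∈ R.closure.verts, r ∉ R.verts := by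
      simp only [IsGraph, not_forall] at hG
      obtain ⟨e, he, r, hr, hrR⟩ := hG
      exact ⟨r, mem_closure_verts.2 (.inr ⟨e, he, hr⟩), hrR⟩
    obtain ⟨r, hr, hrR⟩ := hex
    -- Connectedness allows at most |Y| + 1 = |X| + 1 vertices, so `r` is the only one missing from
    -- `R`.
    have hcard := hC.card_vert_le_card_edgeSet_add_one
    rw [R.closure_isGraph.card_edgeSet, Nat.card_eq_fintype_card, Fintype.card_coe] at hcard
    change _ ≤ R.edges.card + 1 at hcard
    have hins : insert r R.verts = R.closure.verts := by
      refine Finset.eq_of_subset_of_card_le (Finset.insert_subset hr hsub) ?_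
      rw [Finset.card_insert_of_notMem hrR, hsq]
      exact hcard
    have herase : R.verts = R.closure.verts.erase r := by
      rw [← hins, Finset.erase_insert hrR]
    have hT : R.closure.IsTree := by
      refine isTree_iff.2 ⟨R.closure_isGraph, hC, ?_⟩
      rw [← hins, Finset.card_insert_of_notMem hrR, hsq]
      rfl
    have hrt : R.IsRootlessTree := by
      refine ⟨R.closure, hT, r, hr, ?_⟩
      ext v
      · rw [herase]; rfl
      · rfl
    have nI : ¬ R.IsUnicyclicI := fun h => hG h.1.1
    have nII : ¬ R.IsUnicyclicII := fun h => hG h.1.1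
    rw [if_pos (.inl hrt), if_neg nI, if_neg nII]
    simp only [mul_zero, add_zero, pow_zero]
    refine gramDet_eq_one_of_connected hC hr (fun v => ?_) rfl hsq
    rw [herase, Finset.mem_erase, and_comm]

/-! ### Factorization over components and conclusion. -/

/-- The vertices of a component are the fibre of the component map. -/
def componentVertsEquiv (R : G.Substructure) (c : R.incidence.ConnectedComponent) :
    {v : R.verts // R.incidence.connectedComponentMk (Sum.inl v) = c} ≃
      (R.component c).verts where
  toFun v := ⟨v, mem_component_verts.2 ⟨v.1.2, v.2⟩⟩
  invFun v := ⟨⟨v, (mem_component_verts.1 v.2).1⟩, (mem_component_verts.1 v.2).2⟩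
  left_inv _ := rfl
  right_inv _ := rfl

/-- The edges of a component are the fibre of the component map. -/
def componentEdgesEquiv (R : G.Substructure) (c : R.incidence.ConnectedComponent) :
    {e : R.edges // R.incidence.connectedComponentMk (Sum.inr e) = c} ≃
      (R.component c).edges where
  toFun e := ⟨e, mem_component_edges.2 ⟨e.1.2, e.2⟩⟩
  invFun e := ⟨⟨e, (mem_component_edges.1 e.2).1⟩, (mem_component_edges.1 e.2).2⟩
  left_inv _ := rfl
  right_inv _ := rfl

theorem sum_card_component_verts [Fintype R.incidence.ConnectedComponent] :
    ∑ c, (R.component c).verts.card = R.verts.card := by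
  classical
  rw [← Fintype.card_coe R.verts,
    ← Fintype.card_congr (Equiv.sigmaFiberEquiv fun v : R.verts =>
      R.incidence.connectedComponentMk (Sum.inl v)), Fintype.card_sigma]
  refine Fintype.sum_congr _ _ fun c => ?_
  rw [Fintype.card_congr (R.componentVertsEquiv c), Fintype.card_coe]

theorem sum_card_component_edges [Fintype R.incidence.ConnectedComponent] :
    ∑ c, (R.component c).edges.card = R.edges.card := by
  classical
  rw [← Fintype.card_coe R.edges,
    ← Fintype.card_congr (Equiv.sigmaFiberEquiv fun v : R.edges =>
      R.incidence.connectedComponentMk (Sum.inr v)), Fintype.card_sigma]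
  refine Fintype.sum_congr _ _ fun c => ?_
  rw [Fintype.card_congr (R.componentEdgesEquiv c), Fintype.card_coe]

/-- Rows from different components share no edge, so the Gram matrix is block diagonal. The Gram
form makes sense even for components that are not square. -/
theorem gramDet_eq_prod_component [Fintype R.incidence.ConnectedComponent] :
    R.gramDet = ∏ c, (R.component c).gramDet := by
  classical
  have hcomp : ∀ {v : R.verts} {e : R.edges}, G.inc v e ≠ 0 →
      R.incidence.connectedComponentMk (Sum.inl v) =
        R.incidence.connectedComponentMk (Sum.inr e) := fun h =>
    SimpleGraph.ConnectedComponent.sound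
      (SimpleGraph.Adj.reachable (show R.incidence.Adj (Sum.inl _) (Sum.inr _) from
        mem_of_inc_ne_zero h))
  rw [gramDet_eq, Matrix.det_eq_prod_det_toSquareBlock _
    (fun v : R.verts => R.incidence.connectedComponentMk (Sum.inl v))]
  · refine Fintype.prod_congr _ _ fun c => ?_
    rw [gramDet_eq, ← Matrix.det_submatrix_equiv_self (R.componentVertsEquiv c)]
    congr 1
    ext v w
    simp only [Matrix.toSquareBlock_def, Matrix.of_apply, Matrix.submatrix_apply,
      Matrix.mul_apply, Matrix.conjTranspose_apply, incMatrix]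
    rw [← (R.componentEdgesEquiv c).sum_comp]
    have hne : ∀ e ∈ (univ : Finset R.edges),
        G.inc v.1 e * star (G.inc w.1 e) ≠ 0 → R.incidence.connectedComponentMk (Sum.inr e) = c :=
      fun e _ he => (hcomp (left_ne_zero_of_mul he)).symm.trans v.2
    refine (Finset.sum_filter_of_ne hne).symm.trans ?_
    exact Finset.sum_subtype _ (by simp) _
  · intro u v huv
    rw [Matrix.mul_apply]
    refine Finset.sum_eq_zero fun e _ => ?_
    by_contra h0
    simp only [incMatrix, Matrix.conjTranspose_apply, Matrix.of_apply] at h0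
    exact huv ((hcomp (left_ne_zero_of_mul h0)).trans
      (hcomp (star_ne_zero.1 (right_ne_zero_of_mul h0))).symm)

open Classical in
theorem gramDet_of_isSquare (hsq : R.IsSquare) :
    R.gramDet = if R.IsSpecialSquare then 2 ^ (R.numTypeI + 2 * R.numTypeII) else 0 := by
  have : Fintype R.incidence.ConnectedComponent := Fintype.ofFinite _
  rw [gramDet_eq_prod_component]
  by_cases hall : ∀ c, (R.component c).IsSquare
  · rw [Fintype.prod_congr _ _ fun c =>
      gramDet_of_closure_connected (closure_component_connected c) (hall c)]
    by_cases hsp : R.IsSpecialSquare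
    · rw [if_pos hsp, Fintype.prod_congr _ _ fun c => if_pos (show IsSpecialComponent _ from hsp.2 c), Finset.prod_pow_eq_pow_sum,
        Finset.sum_add_distrib, ← Finset.mul_sum, numTypeI, numTypeII,
        Set.ncard_eq_toFinset_card', Set.ncard_eq_toFinset_card']
      simp
    · rw [if_neg hsp]
      have : ∃ c, ¬ (R.component c).IsSpecialComponent := by
        by_contra! h
        exact hsp ⟨hsq, h⟩
      obtain ⟨c, hc⟩ := this
      exact Finset.prod_eq_zero (mem_univ c) (if_neg hc)
  · have hsp : ¬ R.IsSpecialSquare := fun h => hall fun c =>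
      IsSpecialComponent.isSquare (h.2 c)
    rw [if_neg hsp]
    -- The totals agree, so if no component lacked edges, all components would be square.
    have : ∃ c, (R.component c).edges.card < (R.component c).verts.card := by
      by_contra! h
      refine hall fun c => ?_
      have heq : ∑ c, (R.component c).verts.card = ∑ c, (R.component c).edges.card := by
        rw [sum_card_component_verts, sum_card_component_edges]
        exact hsq
      exact (Finset.sum_eq_sum_iff_of_le fun c _ => h c).1 heq c (mem_univ c)
    obtain ⟨c, hc⟩ := this
    exact Finset.prod_eq_zero (mem_univ c) (gramDet_eq_zero_of_card_lt _ hc)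

end Substructure

end MixedGraph

theorem mainTheorem1 {V : Type*} [Fintype V] [DecidableEq V] (G : MixedGraph V) (W : Finset V) :
    (G.quasiLaplacian.submatrix (fun w : W => (w : V)) (fun w : W => (w : V))).det =
      ∑ R : G.Substructure with R.IsSpecialSquare ∧ R.verts = W,
        (2 : ℂ) ^ (R.numTypeI + 2 * R.numTypeII) := by
  classical
  rw [MixedGraph.det_quasiLaplacian_submatrix, Finset.sum_filter, Finset.sum_filter]
  refine Fintype.sum_congr _ _ fun R => ?_
  by_cases hW : R.verts = W
  · by_cases hsq : R.IsSquare
    · simp [hW, hsq, MixedGraph.Substructure.gramDet_of_isSquare hsq]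
    · have hsp : ¬ R.IsSpecialSquare := fun h => hsq h.1
      simp [hsq, hsp]
  · simp [hW]
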